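/- Let $(\Omega,\mathcal F,\mathbb P)$ be a probability space, $T>0$, and let $(\mathcal F_t)_{t\in[0,T]}$ be a filtration satisfying the usual conditions, with $\mathcal F_T=\mathcal F$. Let $\mathcal P$ be the predictable $\sigma$-field on $\Omega\times[0,T]$ and $\tilde{\mathcal P}=\mathcal P\otimes\mathcal B(\mathbb R)$. Let $\mu$ be an integer-valued random measure on $[0,T]\times\mathbb R$ (optional, $\tilde{\mathcal P}$-$\sigma$-finite, with values in $\{0,1,\dots,\infty\}$, with $\mu(\{0\}\times\mathbb R)=0$ and $\mu(\{t\}\times\mathbb R)\le 1$ for all $t$), and let $\nu$ be a version of its compensator (dual predictable projection) such that $\nu(\omega,\{t\}\times\mathbb R)\le1$ for all $(\omega,t)$; as for every random measure here, $\nu(\omega,\{0\}\times\mathbb R)=0$. Put $$\hat\nu_t(de)=\nu(\{t\},de),\qquad J=\{(\omega,t):\hat\nu_t(\omega,\mathbb R)>0\},\qquad K=\{(\omega,t):\hat\nu_t(\omega,\mathbb R)=1\},$$ $\nu^d=\nu\mathbf 1_J$ and $\nu^c=\nu\mathbf 1_{J^c}$. For a $\tilde{\mathcal P}$-measurable $W:\Omega\times[0,T]\times\mathbb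 R\to\mathbb R$ let $\hat W_t=\int_{\mathbb R}W_t(e)\,\hat\nu_t(de)$ (defined when $W_t$ is $\hat\nu_t$-integrable; where it is undefined it is read as $0$ in (1) below), and let $$C(W)_t=\int_{]0,t]\times\mathbb R}|W_s(e)-\hat W_s|^2\,\nu(ds\,de)+\sum_{s\le t}\bigl(1-\hat\nu_s(\mathbb R)\bigr)|\hat W_s|^2\in[0,\infty],$$ with $C(W)_t=\infty$ if $\hat W_s$ is undefined for some $s\le t$. Finally let $\|H\|_{\mathcal L^2(\mu)}=\mathbb E\bigl[\int_{]0,T]\times\mathbb R}|H_s(e)|^2\,\nu(ds\,de)\bigr]\in[0,\infty]$. Let $W$ be $\tilde{\mathcal P}$-measurable. The following two statements are equivalent: 1. $\|W-\hat W\mathbf 1_K\|_{\mathcal L^2(\mu)}=0$; 2. there is a predictable real process $(l_s)$ with $W_s(e)=l_s\mathbf 1_K(s)$, $d\mathbb P\,\nu(ds\,de)$-a.e. Moreover, if $C(W)_T=0$ a.s., then (1) and (2) hold; in particular $W_s(e)=0$, $d\mathbb P\,\nu^c(ds\,de)$-a.e., and there is a predictable real process $(l_s)$ such that $W_s(e)=l_s\mathbf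 1_K(s)$, $d\mathbb P\,\nu^d(ds\,de)$-a.e. -/

import Mathlib

open MeasureTheory Filter Topology
open scoped NNReal ENNReal

noncomputable section

namespace RandomMeasureBSDE

/-- The time interval `[0, T]`; its least element `⊥` is `0`, its greatest element `⊤` is `T`. -/
abbrev Time (T : ℝ≥0) : Type := Set.Iic T

variable {Ω : Type*} {mΩ : MeasurableSpace Ω} {T : ℝ≥0}

/-- Completeness part of the usual conditions: every subset of a `P`-null set belongs to `𝓕 0`
(here `P s` is the outer measure of an arbitrary set `s`). The right-continuity part is Mathlib's
`Filtration.IsRightContinuous`. -/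
def IsCompleteFiltration (P : Measure Ω) (𝓕 : Filtration (Time T) mΩ) : Prop :=
  ∀ s : Set Ω, P s = 0 → MeasurableSet[𝓕 ⊥] s

/-- Right-continuous with left limits. -/
def IsCadlag (x : Time T → ℝ) : Prop :=
  (∀ t, ContinuousWithinAt x (Set.Ici t) t) ∧ ∀ t, ∃ l : ℝ, Tendsto x (𝓝[<] t) (𝓝 l)

/-- The optional `σ`-field on `[0, T] × Ω`, generated by the real càdlàg adapted processes. -/
@[reducible]
def optional (𝓕 : Filtration (Time T) mΩ) : MeasurableSpace (Time T × Ω) :=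
  ⨆ X : {X : Time T → Ω → ℝ // StronglyAdapted 𝓕 X ∧ ∀ ω, IsCadlag (fun t => X t ω)},
    MeasurableSpace.comap (Function.uncurry X.1) Real.measurableSpace

/-- Given a `σ`-field `m` on `[0, T] × Ω`, the measurability of a function of `(t, ω, e)` with
respect to `m ⊗ B(ℝ)`. -/
def MeasurableField {β : Type*} [MeasurableSpace β] (m : MeasurableSpace (Time T × Ω))
    (H : Time T → Ω → ℝ → β) : Prop :=
  Measurable[m.prod Real.measurableSpace] fun p : (Time T × Ω) × ℝ => H p.1.1 p.1.2 p.2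

/-- `(H ⋆ μ)_t (ω) = ∫_{]0,t] × ℝ} H(ω, s, e) μ(ω, ds de)` for nonnegative `H`. -/
def starInt (H : Time T → Ω → ℝ → ℝ≥0∞) (μ : Ω → Measure (Time T × ℝ))
    (t : Time T) (ω : Ω) : ℝ≥0∞ :=
  ∫⁻ z in Set.Ioc ⊥ t ×ˢ Set.univ, H z.1 ω z.2 ∂(μ ω)

/-- The fibre over time `t`, that is, the measure `μ(ω, {t} × de)` on `ℝ`. -/
def atTime (μ : Ω → Measure (Time T × ℝ)) (t : Time T) (ω : Ω) : Measure ℝ :=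
  ((μ ω).restrict ({t} ×ˢ Set.univ)).map Prod.snd

/-- For `m` a `σ`-field on `[0, T] × Ω` (the optional or the predictable one): `μ` is a random
measure on `[0, T] × ℝ`, not charging time `0`, such that `H ⋆ μ` is an `m`-measurable process
for every nonnegative `m ⊗ B(ℝ)`-measurable `H`. -/
structure IsRandomMeasure (m : MeasurableSpace (Time T × Ω))
    (μ : Ω → Measure (Time T × ℝ)) : Prop where
  zero_at_zero : ∀ ω, μ ω ({⊥} ×ˢ Set.univ) = 0
  measurable_starInt : ∀ H : Time T → Ω → ℝ → ℝ≥0∞, MeasurableField m H →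
    Measurable[m] (Function.uncurry (starInt H μ))

/-- `μ` is an integer-valued random measure: it is optional, `P̃`-`σ`-finite, takes values in
`{0, 1, …, ∞}`, and charges every time slice with mass at most one. -/
structure IsIntegerValuedRandomMeasure (P : Measure Ω) (𝓕 : Filtration (Time T) mΩ)
    (μ : Ω → Measure (Time T × ℝ)) : Prop where
  isOptional : IsRandomMeasure (optional 𝓕) μ
  sigmaFinite : ∃ V : Time T → Ω → ℝ → ℝ, MeasurableField 𝓕.predictable V ∧
    (∀ t ω e, 0 < V t ω e) ∧ ∫⁻ ω, starInt (fun t ω e => ENNReal.ofReal (V t ω e)) μ ⊤ ω ∂P < ⊤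
  slice_le_one : ∀ ω t, μ ω ({t} ×ˢ Set.univ) ≤ 1
  integer_valued : ∀ ω (A : Set (Time T × ℝ)), MeasurableSet A → ∃ n : ℕ∞, μ ω A = n

/-- `ν` is a version of the compensator (dual predictable projection) of `μ`: a predictable random
measure with `E[(H ⋆ ν)_T] = E[(H ⋆ μ)_T]` for all nonnegative `P ⊗ B(ℝ)`-measurable `H`. -/
structure IsCompensator (P : Measure Ω) (𝓕 : Filtration (Time T) mΩ)
    (μ ν : Ω → Measure (Time T × ℝ)) : Prop where
  isPredictable : IsRandomMeasure 𝓕.predictable ν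
  lintegral_eq : ∀ H : Time T → Ω → ℝ → ℝ≥0∞, MeasurableField 𝓕.predictable H →
    ∫⁻ ω, starInt H ν ⊤ ω ∂P = ∫⁻ ω, starInt H μ ⊤ ω ∂P

/-- A good version of the compensator satisfies `ν(ω, {t} × ℝ) ≤ 1` identically. -/
structure IsGoodCompensator (P : Measure Ω) (𝓕 : Filtration (Time T) mΩ)
    (μ ν : Ω → Measure (Time T × ℝ)) : Prop extends IsCompensator P 𝓕 μ ν where
  slice_le_one : ∀ ω t, ν ω ({t} ×ˢ Set.univ) ≤ 1

/-- `J = {(t, ω) : ν(ω, {t} × ℝ) > 0}`. -/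
def setJ (ν : Ω → Measure (Time T × ℝ)) : Set (Time T × Ω) :=
  {p | 0 < ν p.2 ({p.1} ×ˢ Set.univ)}

/-- `K = {(t, ω) : ν(ω, {t} × ℝ) = 1}`. -/
def setK (ν : Ω → Measure (Time T × ℝ)) : Set (Time T × Ω) :=
  {p | ν p.2 ({p.1} ×ˢ Set.univ) = 1}

/-- The process `1_K`. -/
def indK (ν : Ω → Measure (Time T × ℝ)) (t : Time T) (ω : Ω) : ℝ :=
  (setK ν).indicator (fun _ => 1) (t, ω)

/-- `ν^d = ν 1_J`. -/
def discretePart (ν : Ω → Measure (Time T × ℝ)) (ω : Ω) : Measure (Time T × ℝ) :=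
  (ν ω).restrict {z | (z.1, ω) ∈ setJ ν}

/-- `ν^c = ν 1_{J^c}`. -/
def continuousPart (ν : Ω → Measure (Time T × ℝ)) (ω : Ω) : Measure (Time T × ℝ) :=
  (ν ω).restrict {z | (z.1, ω) ∉ setJ ν}

/-- `Ŵ_t = ∫_ℝ W_t(e) ν({t} × de)`; it is defined when `W_t` is integrable for that measure
(see `HatDefined`). -/
def hat (ν : Ω → Measure (Time T × ℝ)) (W : Time T → Ω → ℝ → ℝ) (t : Time T) (ω : Ω) : ℝ :=
  ∫ e, W t ω e ∂(atTime ν t ω)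

/-- The integral defining `Ŵ_t(ω)` converges absolutely. -/
def HatDefined (ν : Ω → Measure (Time T × ℝ)) (W : Time T → Ω → ℝ → ℝ)
    (t : Time T) (ω : Ω) : Prop :=
  Integrable (W t ω) (atTime ν t ω)

open scoped Classical in
/-- `C(W)_t = (|W - Ŵ|² ⋆ ν)_t + ∑_{s ≤ t} (1 - ν({s} × ℝ)) |Ŵ_s|²`, with values in `[0, ∞]`; it is
`∞` as soon as some `Ŵ_s`, `s ≤ t`, is undefined. -/
def processC (ν : Ω → Measure (Time T × ℝ)) (W : Time T → Ω → ℝ → ℝ)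
    (t : Time T) (ω : Ω) : ℝ≥0∞ :=
  if ∀ s ≤ t, HatDefined ν W s ω then
    starInt (fun s ω e => ENNReal.ofReal (|W s ω e - hat ν W s ω| ^ 2)) ν t ω +
      ∑' s : Set.Iic t, (1 - ν ω ({s.1} ×ˢ Set.univ)) * ENNReal.ofReal (|hat ν W s.1 ω| ^ 2)
  else ⊤

/-- `‖H‖_{L²(μ)} = E[∫_{]0,T] × ℝ} |H_s(e)|² ν(ds de)]`, with values in `[0, ∞]`, where `ν` is the
compensator of `μ`. -/
def normL2 (P : Measure Ω) (ν : Ω → Measure (Time T × ℝ)) (H : Time T → Ω → ℝ → ℝ) : ℝ≥0∞ :=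
  ∫⁻ ω, starInt (fun s ω e => ENNReal.ofReal (|H s ω e| ^ 2)) ν ⊤ ω ∂P

/-- The property `p` holds `dP ρ(ds de)`-almost everywhere. -/
def AEField (P : Measure Ω) (ρ : Ω → Measure (Time T × ℝ)) (p : Time T → Ω → ℝ → Prop) : Prop :=
  ∀ᵐ ω ∂P, ∀ᵐ z ∂(ρ ω), p z.1 ω z.2

end RandomMeasureBSDE

end

/-!
The key point is that `Ŵ` and `1_K` are predictable up to evanescence. If `H ≤ c V` with
`V ⋆ ν < ∞`, the slice integral `∫ H_t(e) ν({t} × de)` is the jump at `t` of the increasing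
predictable process `H ⋆ ν`, whose left limits are countable suprema of processes
`1_{]q, ∞[} (H ⋆ ν)_q` and hence predictable (`measurable_leftInt`). A general nonnegative `H` is
the increasing limit of `min H (n V)`, where `V > 0` is a weight given by the `P̃`-`σ`-finiteness
of `μ`, transferred to `ν` by the compensator identity; this gives predictability of all slice
integrals on the predictable set `{V ⋆ ν < ∞}`, of which almost every `ω`-section is the whole
time interval (`measurable_indicator_sliceInt`, `measurable_indicator_hat`).

Consequently `W - Ŵ 1_K` has a `P̃`-measurable version, and `‖W - Ŵ 1_K‖ = 0` means that
`W = Ŵ 1_K` almost everywhere, so that the predictable version of `Ŵ` serves as `l`. Conversely, if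
`W = l 1_K` almost everywhere, then for `s ∈ K` the function `W_s` equals `l_s` almost everywhere
for the probability measure `ν({s} × de)`, whence `Ŵ_s = l_s`. Finally `C(W)_T = 0` forces `W = Ŵ`
almost everywhere and `Ŵ_s = 0` whenever `ν({s} × ℝ) < 1`, that is `Ŵ = Ŵ 1_K`.
-/

namespace RandomMeasureBSDE

variable {Ω : Type*} {mΩ : MeasurableSpace Ω} {T : ℝ≥0}

/-! ### Measurability of sections -/

section Sections

variable {𝓕 : Filtration (Time T) mΩ}

lemma measurable_mk_predictable (ω : Ω) :
    Measurable[_, 𝓕.predictable] (fun t : Time T => (t, ω)) := by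
  have h : 𝓕.predictable ≤ (inferInstance : MeasurableSpace (Time T × Ω)) :=
    measurableSpace_le_predictable_of_measurableSet
      (fun A hA => (measurableSet_singleton _).prod (𝓕.le _ _ hA))
      (fun i A hA => measurableSet_Ioi.prod (𝓕.le _ _ hA))
  exact fun s hs => measurable_prodMk_right (h s hs)

lemma measurable_at_of_predictable {u : Time T × Ω → ℝ≥0∞} (hu : Measurable[𝓕.predictable] u)
    (t : Time T) : Measurable[𝓕 t] fun ω => u (t, ω) := by
  have h : IsStronglyPredictable 𝓕 (fun t ω => u (t, ω)) :=
    show StronglyMeasurable[𝓕.predictable] u from Measurable.stronglyMeasurable hu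
  exact (h.stronglyAdapted t).measurable

lemma MeasurableField.measurable_section {β : Type*} [MeasurableSpace β]
    {H : Time T → Ω → ℝ → β} (hH : MeasurableField 𝓕.predictable H) (ω : Ω) :
    Measurable fun z : Time T × ℝ => H z.1 ω z.2 := by
  have h : Measurable[_, 𝓕.predictable.prod Real.measurableSpace]
      fun z : Time T × ℝ => ((z.1, ω), z.2) :=
    Measurable.prodMk (Measurable.comp (measurable_mk_predictable ω) measurable_fst)
      measurable_snd
  exact Measurable.comp hH h

lemma MeasurableField.measurable_slice {β : Type*} [MeasurableSpace β]
    {H : Time T → Ω → ℝ → β} (hH : MeasurableField 𝓕.predictable H) (t : Time T) (ω : Ω) :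
    Measurable (H t ω) :=
  (hH.measurable_section ω).comp (measurable_prodMk_left (x := t))

lemma MeasurableField.of_process {β : Type*} [MeasurableSpace β]
    {f : Time T × Ω → β} (hf : Measurable[𝓕.predictable] f) :
    MeasurableField 𝓕.predictable fun t ω _ => f (t, ω) :=
  Measurable.comp hf (@measurable_fst _ _ 𝓕.predictable Real.measurableSpace)

/-- A `𝓕 q`-measurable variable switched on strictly after time `q` is a predictable process. -/
lemma measurable_predictable_indicator_Ioi {q : Time T} {X : Ω → ℝ≥0∞}
    (hX : Measurable[𝓕 q] X) :
    Measurable[𝓕.predictable] fun p : Time T × Ω => (Set.Ioi q).indicator (fun _ => X p.2) p.1 := by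
  intro S hS
  have h1 : MeasurableSet[𝓕.predictable] (Set.Ioi q ×ˢ (X ⁻¹' S)) :=
    measurableSet_predictable_Ioi_prod (hX hS)
  have h2 : MeasurableSet[𝓕.predictable] (Set.Ioi q ×ˢ (Set.univ : Set Ω)) :=
    measurableSet_predictable_Ioi_prod MeasurableSet.univ
  by_cases h0 : (0 : ℝ≥0∞) ∈ S
  · convert MeasurableSet.union h1 h2.compl using 1
    ext p
    by_cases hp : q < p.1 <;> simp [Set.indicator, hp, h0]
  · convert h1 using 1
    ext p
    by_cases hp : q < p.1 <;> simp [Set.indicator, hp, h0]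

end Sections

/-! ### Slice integrals as jumps -/

/-- The integral `∫ H_t(e) ν({t} × de)` of a nonnegative field over the slice at time `t`. -/
noncomputable def sliceInt (H : Time T → Ω → ℝ → ℝ≥0∞) (ν : Ω → Measure (Time T × ℝ))
    (p : Time T × Ω) : ℝ≥0∞ :=
  ∫⁻ e, H p.1 p.2 e ∂(atTime ν p.1 p.2)

/-- The left limit `(H ⋆ ν)_{t-}`, as an integral over `]0, t[ × ℝ`. -/
noncomputable def leftInt (H : Time T → Ω → ℝ → ℝ≥0∞) (ν : Ω → Measure (Time T × ℝ))
    (p : Time T × Ω) : ℝ≥0∞ :=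
  ∫⁻ z in Set.Ioo ⊥ p.1 ×ˢ Set.univ, H z.1 p.2 z.2 ∂(ν p.2)

section Slices

variable {𝓕 : Filtration (Time T) mΩ} {ν : Ω → Measure (Time T × ℝ)}

lemma measurable_leftInt (hν : IsRandomMeasure 𝓕.predictable ν)
    {H : Time T → Ω → ℝ → ℝ≥0∞} (hH : MeasurableField 𝓕.predictable H) :
    Measurable[𝓕.predictable] (leftInt H ν) := by
  obtain ⟨D, hDc, hDd⟩ := TopologicalSpace.exists_countable_dense (Time T)
  have : Countable D := hDc
  have key : leftInt H ν = fun p => ⨆ q : D,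
      (Set.Ioi q.1).indicator (fun _ => starInt H ν q.1 p.2) p.1 := by
    funext ⟨t, ω⟩
    have hset : Set.Ioo ⊥ t ×ˢ (Set.univ : Set ℝ) =
        ⋃ q : {q : D // q.1 < t}, Set.Ioc ⊥ q.1.1 ×ˢ (Set.univ : Set ℝ) := by
      ext ⟨s, e⟩
      simp only [Set.mem_prod, Set.mem_Ioo, Set.mem_univ, and_true, Set.mem_iUnion, Set.mem_Ioc]
      constructor
      · rintro ⟨h0, h1⟩
        obtain ⟨q, hq, hq1, hq2⟩ := hDd.exists_between h1
        exact ⟨⟨⟨q, hq⟩, hq2⟩, h0, hq1.le⟩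
      · rintro ⟨q, h0, h1⟩
        exact ⟨h0, h1.trans_lt q.2⟩
    have hdir : Directed (· ⊆ ·) fun q : {q : D // q.1 < t} =>
        Set.Ioc ⊥ q.1.1 ×ˢ (Set.univ : Set ℝ) :=
      Monotone.directed_le fun a b hab =>
        Set.prod_mono_left (Set.Ioc_subset_Ioc_right hab)
    simp only [leftInt, hset]
    rw [setLIntegral_iUnion_of_directed _ hdir, iSup_subtype]
    refine iSup_congr fun q => ?_
    by_cases hq : q.1 < t <;> simp [hq, starInt]
  rw [key]
  refine Measurable.iSup fun q => measurable_predictable_indicator_Ioi ?_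
  exact measurable_at_of_predictable (hν.measurable_starInt H hH) q.1

lemma starInt_eq_leftInt_add_sliceInt (h0 : ∀ ω, ν ω ({⊥} ×ˢ Set.univ) = 0)
    {H : Time T → Ω → ℝ → ℝ≥0∞} (hH : MeasurableField 𝓕.predictable H) (p : Time T × Ω) :
    starInt H ν p.1 p.2 = leftInt H ν p + sliceInt H ν p := by
  obtain ⟨t, ω⟩ := p
  have hslice : sliceInt H ν (t, ω) = ∫⁻ z in {t} ×ˢ Set.univ, H z.1 ω z.2 ∂(ν ω) := by
    rw [sliceInt, atTime, lintegral_map (hH.measurable_slice t ω) measurable_snd]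
    refine setLIntegral_congr_fun ((measurableSet_singleton t).prod MeasurableSet.univ) ?_
    rintro ⟨s, e⟩ ⟨hs, -⟩
    simp only [Set.mem_singleton_iff] at hs
    simp [hs]
  rw [hslice]
  rcases eq_or_ne t ⊥ with rfl | ht
  · simp [starInt, leftInt, setLIntegral_measure_zero _ _ (h0 ω)]
  · have hu : Set.Ioc ⊥ t ×ˢ (Set.univ : Set ℝ) =
        Set.Ioo ⊥ t ×ˢ Set.univ ∪ {t} ×ˢ Set.univ := by
      rw [← Set.union_prod, Set.Ioo_union_right (bot_lt_iff_ne_bot.2 ht)]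
    simp only [starInt, leftInt, hu]
    refine lintegral_union ((measurableSet_singleton t).prod MeasurableSet.univ) ?_
    rw [Set.disjoint_left]
    rintro ⟨s, e⟩ ⟨h1, -⟩ ⟨h2, -⟩
    exact absurd h2 h1.2.ne

lemma measurableSet_starInt_lt_top (hν : IsRandomMeasure 𝓕.predictable ν)
    {V : Time T → Ω → ℝ → ℝ≥0∞} (hV : MeasurableField 𝓕.predictable V) :
    MeasurableSet[𝓕.predictable] {p : Time T × Ω | starInt V ν p.1 p.2 < ⊤} :=
  hν.measurable_starInt V hV measurableSet_Iio

/-- Where `V ⋆ ν` is finite, slice integrals are predictable. The field `H` is approximated from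
below by `min H (n V)`, for which `H ⋆ ν` is finite, so that its jumps are differences. -/
lemma measurable_indicator_sliceInt (hν : IsRandomMeasure 𝓕.predictable ν)
    {V H : Time T → Ω → ℝ → ℝ≥0∞} (hV : MeasurableField 𝓕.predictable V)
    (hVpos : ∀ t ω e, V t ω e ≠ 0) (hH : MeasurableField 𝓕.predictable H) :
    Measurable[𝓕.predictable]
      ({p : Time T × Ω | starInt V ν p.1 p.2 < ⊤}.indicator (sliceInt H ν)) := by
  set D := {p : Time T × Ω | starInt V ν p.1 p.2 < ⊤}
  set G : ℕ → Time T → Ω → ℝ → ℝ≥0∞ := fun n t ω e => min (H t ω e) (n * V t ω e)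
  have hG : ∀ n, MeasurableField 𝓕.predictable (G n) := fun n =>
    Measurable.min hH (Measurable.const_mul hV _)
  have key : D.indicator (sliceInt H ν) = fun p => ⨆ n,
      D.indicator (fun p => starInt (G n) ν p.1 p.2 - leftInt (G n) ν p) p := by
    funext p
    by_cases hp : p ∈ D
    · simp only [Set.indicator_of_mem hp]
      have hsub : ∀ n, starInt (G n) ν p.1 p.2 - leftInt (G n) ν p = sliceInt (G n) ν p := by
        intro n
        have hfin : starInt (G n) ν p.1 p.2 < ⊤ := by
          calc starInt (G n) ν p.1 p.2
              ≤ ∫⁻ z in Set.Ioc ⊥ p.1 ×ˢ Set.univ, n * V z.1 p.2 z.2 ∂(ν p.2) :=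
                lintegral_mono fun z => min_le_right _ _
            _ = n * starInt V ν p.1 p.2 :=
                lintegral_const_mul _ (hV.measurable_section p.2)
            _ < ⊤ := ENNReal.mul_lt_top (ENNReal.natCast_lt_top n) hp
        rw [starInt_eq_leftInt_add_sliceInt hν.zero_at_zero (hG n)] at hfin ⊢
        exact ENNReal.add_sub_cancel_left
          (lt_of_le_of_lt (self_le_add_right _ _) hfin).ne
      simp only [hsub, sliceInt]
      rw [← lintegral_iSup (fun n => (hG n).measurable_slice p.1 p.2)]
      · refine lintegral_congr fun e => ?_
        simp only [G]
        rw [← inf_iSup_eq, ← ENNReal.iSup_mul, ENNReal.iSup_natCast,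
          ENNReal.top_mul (hVpos _ _ _), inf_top_eq]
      · intro m n hmn e
        simp only [G]
        gcongr
    · simp [Set.indicator_of_notMem hp]
  rw [key]
  refine Measurable.iSup fun n => ?_
  refine Measurable.indicator ?_ (measurableSet_starInt_lt_top hν hV)
  exact Measurable.sub (hν.measurable_starInt _ (hG n)) (measurable_leftInt hν (hG n))

lemma atTime_univ (ν : Ω → Measure (Time T × ℝ)) (t : Time T) (ω : Ω) :
    atTime ν t ω Set.univ = ν ω ({t} ×ˢ Set.univ) := by
  rw [atTime, Measure.map_apply measurable_snd MeasurableSet.univ]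
  simp

lemma measurable_indicator_indK (hν : IsRandomMeasure 𝓕.predictable ν)
    {V : Time T → Ω → ℝ → ℝ≥0∞} (hV : MeasurableField 𝓕.predictable V)
    (hVpos : ∀ t ω e, V t ω e ≠ 0) :
    Measurable[𝓕.predictable]
      ({p : Time T × Ω | starInt V ν p.1 p.2 < ⊤}.indicator (Function.uncurry (indK ν))) := by
  set D := {p : Time T × Ω | starInt V ν p.1 p.2 < ⊤}
  have h1 : Measurable[𝓕.predictable] (D.indicator (sliceInt (fun _ _ _ => 1) ν)) :=
    measurable_indicator_sliceInt hν hV hVpos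
      (@measurable_const _ _ _ (𝓕.predictable.prod Real.measurableSpace) _)
  have h2 : D.indicator (Function.uncurry (indK ν)) =
      (D.indicator (sliceInt (fun _ _ _ => 1) ν) ⁻¹' {1}).indicator fun _ => (1 : ℝ) := by
    funext p
    by_cases hp : p ∈ D
    · simp [Set.indicator, hp, Function.uncurry, indK, setK, sliceInt, atTime_univ]
    · simp [Set.indicator, hp]
  rw [h2]
  exact Measurable.indicator (@measurable_const _ _ _ 𝓕.predictable _)
    (h1 (measurableSet_singleton 1))

open scoped Classical in
lemma hat_eq_ite {W : Time T → Ω → ℝ → ℝ} (hW : MeasurableField 𝓕.predictable W)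
    (p : Time T × Ω) :
    hat ν W p.1 p.2 =
      if sliceInt (fun t ω e => ENNReal.ofReal (W t ω e)) ν p < ⊤ ∧
        sliceInt (fun t ω e => ENNReal.ofReal (-W t ω e)) ν p < ⊤ then
        (sliceInt (fun t ω e => ENNReal.ofReal (W t ω e)) ν p).toReal -
          (sliceInt (fun t ω e => ENNReal.ofReal (-W t ω e)) ν p).toReal
      else 0 := by
  have hm := hW.measurable_slice p.1 p.2
  split_ifs with h
  · refine integral_eq_lintegral_pos_part_sub_lintegral_neg_part ⟨hm.aestronglyMeasurable, ?_⟩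
    have habs : ∀ x : ℝ, ‖x‖ₑ = ENNReal.ofReal x + ENNReal.ofReal (-x) := by
      intro x
      rw [← ofReal_norm, Real.norm_eq_abs]
      rcases le_total 0 x with hx | hx
      · simp [abs_of_nonneg hx, ENNReal.ofReal_of_nonpos (neg_nonpos.2 hx)]
      · simp [abs_of_nonpos hx, ENNReal.ofReal_of_nonpos hx]
    simp only [HasFiniteIntegral, habs]
    rw [lintegral_add_left hm.ennreal_ofReal]
    exact ENNReal.add_lt_top.2 h
  · -- an undefined `Ŵ` is read as `0`, the value of the Bochner integral
    refine integral_undef fun hi => h ⟨?_, ?_⟩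
    · exact hi.lintegral_lt_top
    · exact hi.neg.lintegral_lt_top

/-- Where `V ⋆ ν` is finite, the process `Ŵ` is predictable. -/
lemma measurable_indicator_hat (hν : IsRandomMeasure 𝓕.predictable ν)
    {V : Time T → Ω → ℝ → ℝ≥0∞} (hV : MeasurableField 𝓕.predictable V)
    (hVpos : ∀ t ω e, V t ω e ≠ 0) {W : Time T → Ω → ℝ → ℝ}
    (hW : MeasurableField 𝓕.predictable W) :
    Measurable[𝓕.predictable]
      ({p : Time T × Ω | starInt V ν p.1 p.2 < ⊤}.indicator (Function.uncurry (hat ν W))) := by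
  classical
  set D := {p : Time T × Ω | starInt V ν p.1 p.2 < ⊤}
  set a := D.indicator (sliceInt (fun t ω e => ENNReal.ofReal (W t ω e)) ν) with ha
  set b := D.indicator (sliceInt (fun t ω e => ENNReal.ofReal (-W t ω e)) ν) with hb
  have ham : Measurable[𝓕.predictable] a :=
    measurable_indicator_sliceInt hν hV hVpos (Measurable.ennreal_ofReal hW)
  have hbm : Measurable[𝓕.predictable] b :=
    measurable_indicator_sliceInt hν hV hVpos (Measurable.ennreal_ofReal (Measurable.neg hW))
  have key : D.indicator (Function.uncurry (hat ν W)) =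
      fun p => if a p < ⊤ ∧ b p < ⊤ then (a p).toReal - (b p).toReal else 0 := by
    funext p
    by_cases hp : p ∈ D
    · simp only [ha, hb, Set.indicator_of_mem hp]
      exact hat_eq_ite hW p
    · simp [ha, hb, Set.indicator_of_notMem hp]
  rw [key]
  exact Measurable.ite (MeasurableSet.inter (ham measurableSet_Iio) (hbm measurableSet_Iio))
    (Measurable.sub (Measurable.ennreal_toReal ham) (Measurable.ennreal_toReal hbm))
    (@measurable_const _ _ _ 𝓕.predictable _)

/-- Up to evanescence, `Ŵ` and `1_K` are predictable. -/
lemma exists_predictable_versions {P : Measure Ω} {μ : Ω → Measure (Time T × ℝ)}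
    (hμ : IsIntegerValuedRandomMeasure P 𝓕 μ) (hν : IsCompensator P 𝓕 μ ν)
    {W : Time T → Ω → ℝ → ℝ} (hW : MeasurableField 𝓕.predictable W) :
    ∃ l k : Time T × Ω → ℝ, Measurable[𝓕.predictable] l ∧ Measurable[𝓕.predictable] k ∧
      ∀ᵐ ω ∂P, ∀ t, l (t, ω) = hat ν W t ω ∧ k (t, ω) = indK ν t ω := by
  obtain ⟨V, hV, hVpos, hVint⟩ := hμ.sigmaFinite
  have hV' : MeasurableField 𝓕.predictable fun t ω e => ENNReal.ofReal (V t ω e) :=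
    Measurable.ennreal_ofReal hV
  have hVpos' : ∀ t ω e, ENNReal.ofReal (V t ω e) ≠ 0 := fun t ω e =>
    (ENNReal.ofReal_pos.2 (hVpos t ω e)).ne'
  refine ⟨_, _, measurable_indicator_hat hν.isPredictable hV' hVpos' hW,
    measurable_indicator_indK hν.isPredictable hV' hVpos', ?_⟩
  rw [← hν.lintegral_eq _ hV'] at hVint
  have hmeas : Measurable fun ω => starInt (fun t ω e => ENNReal.ofReal (V t ω e)) ν ⊤ ω :=
    (measurable_at_of_predictable (hν.isPredictable.measurable_starInt _ hV') ⊤).mono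
      (𝓕.le _) le_rfl
  filter_upwards [ae_lt_top hmeas hVint.ne] with ω hω t
  have hmem : (t, ω) ∈ {p : Time T × Ω |
      starInt (fun t ω e => ENNReal.ofReal (V t ω e)) ν p.1 p.2 < ⊤} :=
    lt_of_le_of_lt (lintegral_mono_set
      (Set.prod_mono_left (Set.Ioc_subset_Ioc_right le_top))) hω
  rw [Set.indicator_of_mem hmem, Set.indicator_of_mem hmem]
  exact ⟨rfl, rfl⟩

end Slices

/-! ### Vanishing of the norm -/

section Norm

variable {𝓕 : Filtration (Time T) mΩ} {ν : Ω → Measure (Time T × ℝ)}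

/-- No mass is lost by integrating over `]0, T]` only, as `ν` does not charge time `0`. -/
lemma ae_eq_zero_of_starInt_eq_zero {ω : Ω} (h0 : ν ω ({⊥} ×ˢ Set.univ) = 0)
    {H : Time T → Ω → ℝ → ℝ} (hH : Measurable fun z : Time T × ℝ => H z.1 ω z.2)
    (h : starInt (fun s ω e => ENNReal.ofReal (|H s ω e| ^ 2)) ν ⊤ ω = 0) :
    ∀ᵐ z ∂(ν ω), H z.1 ω z.2 = 0 := by
  have hm : Measurable fun z : Time T × ℝ => ENNReal.ofReal (|H z.1 ω z.2| ^ 2) :=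
    ((measurable_norm.comp hH).pow_const 2).ennreal_ofReal
  rw [starInt, lintegral_eq_zero_iff hm, Filter.EventuallyEq,
    ae_restrict_iff' (measurableSet_Ioc.prod MeasurableSet.univ)] at h
  have h0' : ∀ᵐ z ∂(ν ω), z ∉ ({⊥} : Set (Time T)) ×ˢ (Set.univ : Set ℝ) :=
    measure_eq_zero_iff_ae_notMem.1 h0
  filter_upwards [h, h0'] with z hz hz0
  have hzpos : z ∈ Set.Ioc (⊥ : Time T) ⊤ ×ˢ (Set.univ : Set ℝ) :=
    ⟨⟨bot_lt_iff_ne_bot.2 fun hb => hz0 ⟨hb, trivial⟩, le_top⟩, trivial⟩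
  have h2 : |H z.1 ω z.2| ^ 2 ≤ 0 := ENNReal.ofReal_eq_zero.1 (hz hzpos)
  exact abs_eq_zero.1 (pow_eq_zero_iff two_ne_zero |>.1 (le_antisymm h2 (by positivity)))

lemma normL2_eq_zero_of_aeField {P : Measure Ω} {H : Time T → Ω → ℝ → ℝ}
    (h : AEField P ν fun s ω e => H s ω e = 0) : normL2 P ν H = 0 := by
  refine lintegral_eq_zero_of_ae_eq_zero ?_
  filter_upwards [h] with ω hω
  refine lintegral_eq_zero_of_ae_eq_zero (ae_restrict_of_ae ?_)
  filter_upwards [hω] with z hz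
  simp [hz]

lemma aeField_of_normL2_eq_zero {P : Measure Ω} (hν : IsRandomMeasure 𝓕.predictable ν)
    {H G : Time T → Ω → ℝ → ℝ} (hG : MeasurableField 𝓕.predictable G)
    (hHG : ∀ᵐ ω ∂P, ∀ s e, H s ω e = G s ω e) (h : normL2 P ν H = 0) :
    AEField P ν fun s ω e => H s ω e = 0 := by
  have hG2 : MeasurableField 𝓕.predictable fun s ω e => ENNReal.ofReal (|G s ω e| ^ 2) :=
    Measurable.ennreal_ofReal (Measurable.pow_const (measurable_norm.comp hG) 2)
  have hmeas : Measurable fun ω => starInt (fun s ω e => ENNReal.ofReal (|G s ω e| ^ 2)) ν ⊤ ω :=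
    (measurable_at_of_predictable (hν.measurable_starInt _ hG2) ⊤).mono (𝓕.le _) le_rfl
  have hGH : normL2 P ν G = 0 := by
    rw [← h]
    refine lintegral_congr_ae ?_
    filter_upwards [hHG] with ω hω
    simp [starInt, hω]
  filter_upwards [(lintegral_eq_zero_iff hmeas).1 hGH, hHG] with ω hω hω'
  filter_upwards [ae_eq_zero_of_starInt_eq_zero (hν.zero_at_zero ω)
    (hG.measurable_section ω) hω] with z hz
  rw [hω', hz]

/-- On `K` the slice is a probability measure, so that `Ŵ` recovers the common value of `W`. -/
lemma hat_eq_of_ae_eq_mul_indK {W : Time T → Ω → ℝ → ℝ} {ω : Ω} {l : Time T → ℝ}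
    {t : Time T} (hW : Measurable (W t ω))
    (h : ∀ᵐ z ∂(ν ω), W z.1 ω z.2 = l z.1 * indK ν z.1 ω)
    (ht : (t, ω) ∈ setK ν) : hat ν W t ω = l t := by
  have hae : ∀ᵐ e ∂(atTime ν t ω), W t ω e = l t := by
    have hr : ∀ᵐ z ∂((ν ω).restrict ({t} ×ˢ Set.univ)), W t ω z.2 = l t := by
      rw [ae_restrict_iff' ((measurableSet_singleton t).prod MeasurableSet.univ)]
      filter_upwards [h] with z hz hzt
      have hz1 : z.1 = t := hzt.1
      rw [hz1] at hz
      simpa [indK, ht] using hz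
    exact (ae_map_iff measurable_snd.aemeasurable (hW (measurableSet_singleton _))).2 hr
  have huniv : (atTime ν t ω).real Set.univ = 1 := by
    rw [measureReal_def, atTime_univ, show ν ω ({t} ×ˢ Set.univ) = 1 from ht, ENNReal.toReal_one]
  rw [hat, integral_congr_ae hae, integral_const, huniv, one_smul]

/-- If `C(W)_T` vanishes at `ω`, then `W = Ŵ 1_K` almost everywhere for `ν(ω, ·)`. -/
lemma ae_eq_of_processC_eq_zero {W : Time T → Ω → ℝ → ℝ} {ω : Ω}
    (h0 : ν ω ({⊥} ×ˢ Set.univ) = 0) (h1 : ∀ t, ν ω ({t} ×ˢ Set.univ) ≤ 1)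
    (hm : Measurable fun z : Time T × ℝ => W z.1 ω z.2 - hat ν W z.1 ω)
    (h : processC ν W ⊤ ω = 0) :
    ∀ᵐ z ∂(ν ω), W z.1 ω z.2 - hat ν W z.1 ω * indK ν z.1 ω = 0 := by
  rw [processC] at h
  split_ifs at h with hdef
  · obtain ⟨hint, hsum⟩ := add_eq_zero.1 h
    filter_upwards [ae_eq_zero_of_starInt_eq_zero (H := fun s ω e => W s ω e - hat ν W s ω)
      h0 hm hint] with z hz
    by_cases hK : (z.1, ω) ∈ setK ν
    · simpa [indK, hK] using hz
    · have hlt : ν ω ({z.1} ×ˢ Set.univ) < 1 := lt_of_le_of_ne (h1 z.1) hK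
      have hterm := ENNReal.tsum_eq_zero.1 hsum ⟨z.1, Set.mem_Iic.2 le_top⟩
      have hsq : |hat ν W z.1 ω| ^ 2 ≤ 0 := ENNReal.ofReal_eq_zero.1
        ((mul_eq_zero.1 hterm).resolve_left (tsub_pos_iff_lt.2 hlt).ne')
      have hhat : hat ν W z.1 ω = 0 :=
        abs_eq_zero.1 (pow_eq_zero_iff two_ne_zero |>.1 (le_antisymm hsq (by positivity)))
      simpa [hhat] using hz
  · exact absurd h ENNReal.top_ne_zero

end Norm

end RandomMeasureBSDE

theorem mainTheorem9 {Ω : Type*} {mΩ : MeasurableSpace Ω} (P : MeasureTheory.Measure Ω)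
    [MeasureTheory.IsProbabilityMeasure P] (T : ℝ≥0) (hT : 0 < T)
    (𝓕 : MeasureTheory.Filtration (RandomMeasureBSDE.Time T) mΩ)
    [𝓕.IsRightContinuous]
    (hcomplete : RandomMeasureBSDE.IsCompleteFiltration P 𝓕)
    (hterminal : 𝓕 ⊤ = mΩ)
    (μ ν : Ω → MeasureTheory.Measure (RandomMeasureBSDE.Time T × ℝ))
    (hμ : RandomMeasureBSDE.IsIntegerValuedRandomMeasure P 𝓕 μ)
    (hν : RandomMeasureBSDE.IsGoodCompensator P 𝓕 μ ν)
    (W : RandomMeasureBSDE.Time T → Ω → ℝ → ℝ)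
    (hW : RandomMeasureBSDE.MeasurableField 𝓕.predictable W) :
    -- the two forms of the conclusion are equivalent
    (RandomMeasureBSDE.normL2 P ν (fun s ω e =>
          W s ω e - RandomMeasureBSDE.hat ν W s ω * RandomMeasureBSDE.indK ν s ω) = 0 ↔
        ∃ l : RandomMeasureBSDE.Time T → Ω → ℝ, MeasureTheory.IsStronglyPredictable 𝓕 l ∧
          RandomMeasureBSDE.AEField P ν
            (fun s ω e => W s ω e = l s ω * RandomMeasureBSDE.indK ν s ω)) ∧
    -- and they hold, with their consequences, when `C(W)_T` vanishes almost surely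
    ((∀ᵐ ω ∂P, RandomMeasureBSDE.processC ν W ⊤ ω = 0) →
      RandomMeasureBSDE.normL2 P ν (fun s ω e =>
          W s ω e - RandomMeasureBSDE.hat ν W s ω * RandomMeasureBSDE.indK ν s ω) = 0 ∧
      (∃ l : RandomMeasureBSDE.Time T → Ω → ℝ, MeasureTheory.IsStronglyPredictable 𝓕 l ∧
          RandomMeasureBSDE.AEField P ν
            (fun s ω e => W s ω e = l s ω * RandomMeasureBSDE.indK ν s ω)) ∧
      RandomMeasureBSDE.AEField P (RandomMeasureBSDE.continuousPart ν)
        (fun s ω e => W s ω e = 0) ∧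
      (∃ l : RandomMeasureBSDE.Time T → Ω → ℝ, MeasureTheory.IsStronglyPredictable 𝓕 l ∧
          RandomMeasureBSDE.AEField P (RandomMeasureBSDE.discretePart ν)
            (fun s ω e => W s ω e = l s ω * RandomMeasureBSDE.indK ν s ω))) := by
  obtain ⟨l, k, hl, hk, hlk⟩ :=
    RandomMeasureBSDE.exists_predictable_versions hμ hν.toIsCompensator hW
  have hνp := hν.isPredictable
  -- a `P̃`-measurable version of `W - Ŵ 1_K`
  have hG : RandomMeasureBSDE.MeasurableField 𝓕.predictable
      fun s ω e => W s ω e - l (s, ω) * k (s, ω) :=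
    Measurable.sub hW (RandomMeasureBSDE.MeasurableField.of_process (Measurable.mul hl hk))
  have hlpred : MeasureTheory.IsStronglyPredictable 𝓕 fun s ω => l (s, ω) :=
    show StronglyMeasurable[𝓕.predictable] l from Measurable.stronglyMeasurable hl
  have hforward : RandomMeasureBSDE.normL2 P ν (fun s ω e =>
        W s ω e - RandomMeasureBSDE.hat ν W s ω * RandomMeasureBSDE.indK ν s ω) = 0 →
      ∃ l : RandomMeasureBSDE.Time T → Ω → ℝ, MeasureTheory.IsStronglyPredictable 𝓕 l ∧
        RandomMeasureBSDE.AEField P ν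
          (fun s ω e => W s ω e = l s ω * RandomMeasureBSDE.indK ν s ω) := by
    intro h
    refine ⟨fun s ω => l (s, ω), hlpred, ?_⟩
    have hae := RandomMeasureBSDE.aeField_of_normL2_eq_zero hνp hG
      (by filter_upwards [hlk] with ω hω s e using by rw [(hω s).1, (hω s).2]) h
    filter_upwards [hae, hlk] with ω hω hω'
    filter_upwards [hω] with z hz
    rw [(hω' z.1).1]
    exact sub_eq_zero.1 hz
  refine ⟨⟨hforward, ?_⟩, fun hC => ?_⟩
  · rintro ⟨l', -, hl'⟩
    refine RandomMeasureBSDE.normL2_eq_zero_of_aeField ?_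
    filter_upwards [hl'] with ω hω
    filter_upwards [hω] with z hz
    by_cases hK : (z.1, ω) ∈ RandomMeasureBSDE.setK ν
    · rw [hz, RandomMeasureBSDE.hat_eq_of_ae_eq_mul_indK (l := fun s => l' s ω)
        (hW.measurable_slice z.1 ω) hω hK, sub_self]
    · rw [hz]
      simp [RandomMeasureBSDE.indK, hK]
  · have hnorm : RandomMeasureBSDE.normL2 P ν (fun s ω e =>
        W s ω e - RandomMeasureBSDE.hat ν W s ω * RandomMeasureBSDE.indK ν s ω) = 0 := by
      refine RandomMeasureBSDE.normL2_eq_zero_of_aeField ?_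
      filter_upwards [hC, hlk] with ω hω hω'
      refine RandomMeasureBSDE.ae_eq_of_processC_eq_zero (hνp.zero_at_zero ω)
        (hν.slice_le_one ω) ?_ hω
      have hm : RandomMeasureBSDE.MeasurableField 𝓕.predictable
          fun s ω e => W s ω e - l (s, ω) :=
        Measurable.sub hW (RandomMeasureBSDE.MeasurableField.of_process hl)
      simpa only [(hω' _).1] using hm.measurable_section ω
    obtain ⟨l', hl'pred, hl'⟩ := hforward hnorm
    refine ⟨hnorm, ⟨l', hl'pred, hl'⟩, ?_, l', hl'pred, ?_⟩
    · filter_upwards [hl'] with ω hω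
      have hms : MeasurableSet {z : RandomMeasureBSDE.Time T × ℝ | W z.1 ω z.2 = 0} :=
        hW.measurable_section ω (measurableSet_singleton 0)
      refine (MeasureTheory.ae_restrict_iff hms).2 ?_
      filter_upwards [hω] with z hz hzJ
      -- `K ⊆ J`, so that `1_K` vanishes off `J`
      have hK : (z.1, ω) ∉ RandomMeasureBSDE.setK ν := fun hK =>
        hzJ (show 0 < ν ω ({z.1} ×ˢ Set.univ) by
          rw [show ν ω ({z.1} ×ˢ Set.univ) = 1 from hK]; exact one_pos)
      rw [hz]
      simp [RandomMeasureBSDE.indK, hK]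
    · filter_upwards [hl'] with ω hω using MeasureTheory.ae_restrict_of_ae hω
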